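/- **Lemma 3.1.** Let $M$ be a structure for the language $\{0,1,+,\cdot,\le\}$ of first-order arithmetic that satisfies $\mathrm{I}\Delta_0+\exp$ but does not satisfy $\mathrm{I}\Sigma_1$. Then there exists a proper cut $J\subsetneq M$ that is definable in $M$ by a $\Sigma_1$ formula with parameters from $M$ and is closed under exponentiation: $x\in J$ implies $2^x\in J$. Here $\mathrm{I}\Delta_0$ (respectively $\mathrm{I}\Sigma_1$) consists of the axioms $\mathrm{PA}^-$ of discretely ordered semirings with least element $0$ (including $x<y\rightarrow\exists z\,(x+z=y)$) together with induction for all $\Delta_0$ (respectively $\Sigma_1$) formulas, parameters allowed; $\Delta_0$ formulas are those with only bounded quantifiers, and $\Sigma_1$ formulas consist of a block of existential quantifiers followed by a $\Delta_0$ formula; $\exp$ is the axiom that for every $x$ there exists $y$ with $y=2^x$, where "$y=2^x$" is expressed in the language of arithmetic in the usual way, by coding finite sequences with Gödel's $\beta$ function. A cut in $M$ is a nonempty subset of $M$ which is closed downwards and closed under successor $x\mapsto x+1$. -/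

import Mathlib

open FirstOrder FirstOrder.Language

/-- Function symbols of the language of first-order arithmetic. -/
inductive ArithFunc : ℕ → Type
  | zero : ArithFunc 0
  | one : ArithFunc 0
  | add : ArithFunc 2
  | mul : ArithFunc 2

/-- Relation symbols of the language of first-order arithmetic (besides equality). -/
inductive ArithRel : ℕ → Type
  | le : ArithRel 2

/-- The language `{0, 1, +, ·, ≤}` of first-order arithmetic. -/
def arith : FirstOrder.Language.{0, 0} := ⟨ArithFunc, ArithRel⟩

namespace Arith

instance : arith.IsOrdered := ⟨ArithRel.le⟩

section Terms

variable {β : Type}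

instance : Zero (arith.Term β) := ⟨Constants.term (ArithFunc.zero : arith.Functions 0)⟩

instance : One (arith.Term β) := ⟨Constants.term (ArithFunc.one : arith.Functions 0)⟩

instance : Add (arith.Term β) := ⟨Functions.apply₂ (ArithFunc.add : arith.Functions 2)⟩

instance : Mul (arith.Term β) := ⟨Functions.apply₂ (ArithFunc.mul : arith.Functions 2)⟩

end Terms

/-- A structure for the language of arithmetic is a type with arbitrary `0, 1, +, ·, ≤`. -/
instance structureOfOps {M : Type*} [Zero M] [One M] [Add M] [Mul M] [LE M] :
    arith.Structure M where
  funMap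
  | .zero, _ => 0
  | .one, _ => 1
  | .add, v => v 0 + v 1
  | .mul, v => v 0 * v 1
  RelMap
  | .le, v => v 0 ≤ v 1

section Realize

variable {M : Type*} [Zero M] [One M] [Add M] [Mul M] [LE M] {β : Type} (v : β → M)
  (s t : arith.Term β)

instance : arith.OrderedStructure M := ⟨fun _ => Iff.rfl⟩

@[simp] theorem realize_zero : (0 : arith.Term β).realize v = 0 := rfl

@[simp] theorem realize_one : (1 : arith.Term β).realize v = 1 := rfl

@[simp] theorem realize_add : (s + t).realize v = s.realize v + t.realize v := rfl

@[simp] theorem realize_mul : (s * t).realize v = s.realize v * t.realize v := rfl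

end Realize

/-- The algebraic axioms of discretely ordered semirings (the theory `PA⁻`):
associativity, commutativity, distributivity, the laws of `0` and `1`, the linear order, its
compatibility with `+` and `·`, subtraction, discreteness, and `0` is least. -/
def paMinus : arith.Theory :=
  arith.linearOrderTheory ∪
  { ∀' ∀' ∀' (((&0 + &1) + &2) =' (&0 + (&1 + &2))),
    ∀' ∀' ((&0 + &1) =' (&1 + &0)),
    ∀' ∀' ∀' (((&0 * &1) * &2) =' (&0 * (&1 * &2))),
    ∀' ∀' ((&0 * &1) =' (&1 * &0)),
    ∀' ∀' ∀' ((&0 * (&1 + &2)) =' (&0 * &1 + &0 * &2)),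
    ∀' ((&0 + 0) =' &0),
    ∀' ((&0 * 0) =' 0),
    ∀' ((&0 * 1) =' &0),
    ∀' ∀' ∀' (Term.lt &0 &1 ⟹ Term.lt (&0 + &2) (&1 + &2)),
    ∀' ∀' ∀' (Term.lt 0 &2 ⟹ Term.lt &0 &1 ⟹ Term.lt (&0 * &2) (&1 * &2)),
    ∀' ∀' (Term.lt &0 &1 ⟹ ∃' ((&0 + &2) =' &1)),
    Term.lt 0 1,
    ∀' (Term.lt 0 &0 ⟹ Term.le 1 &0),
    ∀' (Term.le 0 &0) }

/-- The term `t` seen in the scope of one more quantifier; it does not mention the variable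
bound by that quantifier. -/
def up {α : Type} {n : ℕ} (t : arith.Term (α ⊕ Fin n)) : arith.Term (α ⊕ Fin (n + 1)) :=
  t.relabel (Sum.map id Fin.castSucc)

/-- The variable bound by the innermost quantifier. -/
def bvar {α : Type} (n : ℕ) : arith.Term (α ⊕ Fin (n + 1)) :=
  Term.var (Sum.inr (Fin.last n))

/-- `Δ₀` (bounded) formulas: built from atomic formulas by propositional connectives and
bounded quantifiers `∀ x ≤ t`, `∃ x ≤ t`, where `x` does not occur in the term `t`. The primitive
connectives are `⊥` and `⟹`, all others abbreviate formulas built from these. -/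
inductive IsDelta0 {α : Type} : {n : ℕ} → arith.BoundedFormula α n → Prop
  | falsum {n : ℕ} : IsDelta0 (⊥ : arith.BoundedFormula α n)
  | equal {n : ℕ} (s t : arith.Term (α ⊕ Fin n)) : IsDelta0 (s =' t)
  | le {n : ℕ} (s t : arith.Term (α ⊕ Fin n)) : IsDelta0 (s.le t)
  | imp {n : ℕ} {φ ψ : arith.BoundedFormula α n} :
      IsDelta0 φ → IsDelta0 ψ → IsDelta0 (φ ⟹ ψ)
  | ball {n : ℕ} (t : arith.Term (α ⊕ Fin n)) {φ : arith.BoundedFormula α (n + 1)} :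
      IsDelta0 φ → IsDelta0 (∀' ((bvar n).le (up t) ⟹ φ))
  | bex {n : ℕ} (t : arith.Term (α ⊕ Fin n)) {φ : arith.BoundedFormula α (n + 1)} :
      IsDelta0 φ → IsDelta0 (∃' ((bvar n).le (up t) ⊓ φ))

/-- `Σ₁` formulas: a block of existential quantifiers followed by a `Δ₀` formula. -/
inductive IsSigma1 {α : Type} : {n : ℕ} → arith.BoundedFormula α n → Prop
  | of_delta0 {n : ℕ} {φ : arith.BoundedFormula α n} : IsDelta0 φ → IsSigma1 φ
  | ex {n : ℕ} {φ : arith.BoundedFormula α (n + 1)} : IsSigma1 φ → IsSigma1 (∃' φ)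

/-- The induction axiom for `φ(p₁, …, pₙ, x)`, with the parameters `p` (the variables `Sum.inl i`)
universally quantified: `∀ p, φ(p, 0) → ∀ x (φ(p, x) → φ(p, x + 1)) → ∀ x φ(p, x)`. -/
noncomputable def inductionAxiom {n : ℕ} (φ : arith.Formula (Fin n ⊕ Unit)) : arith.Sentence :=
  let atZero : arith.Formula (Fin n) := φ.subst (Sum.elim Term.var fun _ => 0)
  let atSucc : arith.Formula (Fin n ⊕ Unit) :=
    φ.subst (Sum.elim (fun i => Term.var (Sum.inl i)) fun _ => Term.var (Sum.inr ()) + 1)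
  let ind : arith.Formula (Fin n) :=
    atZero ⟹ Formula.iAlls Unit (φ ⟹ atSucc) ⟹ Formula.iAlls Unit φ
  Formula.iAlls (Fin n) (Formula.relabel Sum.inr ind)

/-- `IΔ₀`: `PA⁻` with induction for `Δ₀` formulas. -/
def IDelta0 : arith.Theory :=
  paMinus ∪ {σ | ∃ (n : ℕ) (φ : arith.Formula (Fin n ⊕ Unit)), IsDelta0 φ ∧ σ = inductionAxiom φ}

/-- `IΣ₁`: `PA⁻` with induction for `Σ₁` formulas. -/
def ISigma1 : arith.Theory :=
  paMinus ∪ {σ | ∃ (n : ℕ) (φ : arith.Formula (Fin n ⊕ Unit)), IsSigma1 φ ∧ σ = inductionAxiom φ}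

/-- `r` is the remainder of `a` modulo `(i + 1) b + 1`, i.e. `r` is the `i`-th entry of the sequence
coded by `(a, b)` (Gödel's `β` function). -/
def betaGraph {α : Type} {n : ℕ} (a b i r : arith.Term (α ⊕ Fin n)) : arith.BoundedFormula α n :=
  r.le ((i + 1) * b) ⊓ ∃' (up a =' (bvar n * ((up i + 1) * up b + 1) + up r))

/-- The graph `y = 2 ^ x` of exponentiation (free variables: `0` for `x`, `1` for `y`): some pair
`(a, b)` codes a sequence that starts with `1`, doubles at each step `i < x`, and whose `x`-th entry
is `y`. -/
def expGraph : arith.Formula (Fin 2) :=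
  let x {n : ℕ} : arith.Term (Fin 2 ⊕ Fin n) := Term.var (Sum.inl 0)
  let y {n : ℕ} : arith.Term (Fin 2 ⊕ Fin n) := Term.var (Sum.inl 1)
  ∃' ∃' (betaGraph &0 &1 0 1 ⊓
    ∀' ((&2).lt x ⟹ ∃' (betaGraph &0 &1 &2 &3 ⊓ betaGraph &0 &1 (&2 + 1) (&3 + &3))) ⊓
    betaGraph &0 &1 x y)

/-- The axiom `exp`: for every `x` there is `y` with `y = 2 ^ x`. -/
def expAxiom : arith.Sentence :=
  ∀' ∃' BoundedFormula.relabel (n := 2) Sum.inr expGraph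

section Cuts

variable {M : Type*} [Zero M] [One M] [Add M] [Mul M] [LE M]

/-- A cut: a nonempty subset, closed downwards and under successor. -/
structure IsCut (J : Set M) : Prop where
  nonempty : J.Nonempty
  downward : ∀ x ∈ J, ∀ y, y ≤ x → y ∈ J
  succ : ∀ x ∈ J, x + 1 ∈ J

/-- `J` is definable by a `Σ₁` formula with parameters from `M`. -/
def IsSigma1Definable (J : Set M) : Prop :=
  ∃ (n : ℕ) (φ : arith.Formula (Fin n ⊕ Unit)) (p : Fin n → M), IsSigma1 φ ∧
    ∀ x, x ∈ J ↔ φ.Realize (Sum.elim p fun _ => x)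

/-- `J` is closed under `x ↦ 2 ^ x`. -/
def ClosedUnderExp (J : Set M) : Prop :=
  ∀ x ∈ J, ∀ y, expGraph.Realize ![x, y] → y ∈ J

end Cuts

end Arith

/-! A failure of Σ₁ induction yields a proper Σ₁ cut `I` (`exists_cut_of_not_induction`), possibly
closed under nothing but successor. Closure under exponentiation comes from towers t(0) = 1, t(x +
1) = 2 ^ t(x). The set T of heights at which a tower exists is itself a Σ₁ cut
(`isCut_towerHeights`, `isSigma_towerHeights`). If a Σ₁ cut omits some a in T, the elements lying
below some t(x), with x in the cut, form a Σ₁ cut: one exponentiation costs one step of height, and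
t(a) bounds everything (`exists_exp_closed_of_tower`).

If `I` omits an element of T, this applies to `I`. Otherwise T ⊆ I, so T is proper, and
`exists_exp_closed` argues by cases. If T is closed under exponentiation, it serves. If a ∈ T but a
+ a ∉ T, then {x | a + x ∈ T} is a Σ₁ cut omitting a. If T is closed under doubling but 2 ^ a ∉ T
for some a in T, then {x | 2 ^ x ∈ T} is such a cut.

Only Δ₀ induction is available, while the graph of 2 ^ x is written with unbounded quantifiers. A
β-code of the powers up to N, taken as a parameter, makes the graph Δ₀ up to N (`Code.beta_iff`,
`ex_induction`). Towers are then coded by the binary digits of a single element, extended one pair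
at a time by `exists_insert`. -/

set_option linter.unusedSectionVars false

namespace Arith

/-! ### Semantic Δ₀ definability and its match with formulas. -/

section Definability

variable {M : Type*} [Zero M] [One M] [Add M] [Mul M] [LE M]

/-- Polynomial functions, with parameters, of a distinguished variable and of `n` bound variables. -/
inductive IsTerm : {n : ℕ} → (M → (Fin n → M) → M) → Prop
  | const {n : ℕ} (c : M) : IsTerm (n := n) fun _ _ => c
  | main {n : ℕ} : IsTerm (n := n) fun x _ => x
  | var {n : ℕ} (i : Fin n) : IsTerm fun _ xs => xs i
  | add {n : ℕ} {f g : M → (Fin n → M) → M} :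
      IsTerm f → IsTerm g → IsTerm fun x xs => f x xs + g x xs
  | mul {n : ℕ} {f g : M → (Fin n → M) → M} :
      IsTerm f → IsTerm g → IsTerm fun x xs => f x xs * g x xs

/-- `Δ₀` relations, with parameters, between a distinguished variable and `n` bound variables. -/
inductive D0 : {n : ℕ} → (M → (Fin n → M) → Prop) → Prop
  | falsum {n : ℕ} : D0 (n := n) fun _ _ => False
  | equal {n : ℕ} {f g : M → (Fin n → M) → M} :
      IsTerm f → IsTerm g → D0 fun x xs => f x xs = g x xs
  | le {n : ℕ} {f g : M → (Fin n → M) → M} :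
      IsTerm f → IsTerm g → D0 fun x xs => f x xs ≤ g x xs
  | imp {n : ℕ} {P Q : M → (Fin n → M) → Prop} :
      D0 P → D0 Q → D0 fun x xs => P x xs → Q x xs
  | ball_snoc {n : ℕ} {f : M → (Fin n → M) → M} {P : M → (Fin (n + 1) → M) → Prop} :
      IsTerm f → D0 P → D0 fun x xs => ∀ y, y ≤ f x xs → P x (Fin.snoc xs y)

theorem IsTerm.init {n : ℕ} {f : M → (Fin n → M) → M} (hf : IsTerm f) :
    IsTerm fun x (xs : Fin (n + 1) → M) => f x (Fin.init xs) := by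
  induction hf with
  | const c => exact .const c
  | main => exact .main
  | var i => exact .var i.castSucc
  | add _ _ h₁ h₂ => exact .add h₁ h₂
  | mul _ _ h₁ h₂ => exact .mul h₁ h₂

theorem IsTerm.last {n : ℕ} : IsTerm fun (_ : M) (xs : Fin (n + 1) → M) => xs (Fin.last n) :=
  .var _

/-- The finite set `S` of parameters is fixed before the enumeration `p`, so that two terms can be
built over a common `p` covering both of their sets. -/
theorem IsTerm.exists_term {n : ℕ} {f : M → (Fin n → M) → M} (hf : IsTerm f) :
    ∃ S : Set M, S.Finite ∧ ∀ (α : Type) (p : α → M), S ⊆ Set.range p →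
      ∃ t : arith.Term ((α ⊕ Unit) ⊕ Fin n),
        ∀ x xs, t.realize (Sum.elim (Sum.elim p fun _ => x) xs) = f x xs := by
  induction hf with
  | const c =>
    refine ⟨{c}, Set.finite_singleton c, fun α p hp => ?_⟩
    obtain ⟨i, hi⟩ := hp rfl
    exact ⟨Term.var (Sum.inl (Sum.inl i)), fun x xs => hi⟩
  | main => exact ⟨∅, Set.finite_empty, fun α p _ => ⟨Term.var (Sum.inl (Sum.inr ())), fun _ _ => rfl⟩⟩
  | var i => exact ⟨∅, Set.finite_empty, fun α p _ => ⟨Term.var (Sum.inr i), fun _ _ => rfl⟩⟩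
  | add _ _ h₁ h₂ =>
    obtain ⟨S, hS, h₁⟩ := h₁
    obtain ⟨T, hT, h₂⟩ := h₂
    refine ⟨S ∪ T, hS.union hT, fun α p hp => ?_⟩
    obtain ⟨s, hs⟩ := h₁ α p (Set.subset_union_left.trans hp)
    obtain ⟨t, ht⟩ := h₂ α p (Set.subset_union_right.trans hp)
    exact ⟨s + t, fun x xs => by rw [realize_add, hs, ht]⟩
  | mul _ _ h₁ h₂ =>
    obtain ⟨S, hS, h₁⟩ := h₁
    obtain ⟨T, hT, h₂⟩ := h₂
    refine ⟨S ∪ T, hS.union hT, fun α p hp => ?_⟩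
    obtain ⟨s, hs⟩ := h₁ α p (Set.subset_union_left.trans hp)
    obtain ⟨t, ht⟩ := h₂ α p (Set.subset_union_right.trans hp)
    exact ⟨s * t, fun x xs => by rw [realize_mul, hs, ht]⟩

theorem realize_up {α : Type} {n : ℕ} (t : arith.Term (α ⊕ Fin n)) (v : α → M) (xs : Fin n → M)
    (y : M) : (up t).realize (Sum.elim v (Fin.snoc xs y)) = t.realize (Sum.elim v xs) := by
  rw [up, Term.realize_relabel]
  congr 1
  funext i
  rcases i with i | i <;> simp

theorem realize_bvar {α : Type} {n : ℕ} (v : α → M) (xs : Fin n → M) (y : M) :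
    (bvar n : arith.Term (α ⊕ Fin (n + 1))).realize (Sum.elim v (Fin.snoc xs y)) = y := by
  simp [bvar]

theorem D0.exists_formula {n : ℕ} {P : M → (Fin n → M) → Prop} (hP : D0 P) :
    ∃ S : Set M, S.Finite ∧ ∀ (α : Type) (p : α → M), S ⊆ Set.range p →
      ∃ φ : arith.BoundedFormula (α ⊕ Unit) n, IsDelta0 φ ∧
        ∀ x xs, φ.Realize (Sum.elim p fun _ => x) xs ↔ P x xs := by
  induction hP with
  | falsum => exact ⟨∅, Set.finite_empty, fun α p _ => ⟨⊥, .falsum, fun _ _ => Iff.rfl⟩⟩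
  | equal hf hg =>
    obtain ⟨S, hS, h₁⟩ := hf.exists_term
    obtain ⟨T, hT, h₂⟩ := hg.exists_term
    refine ⟨S ∪ T, hS.union hT, fun α p hp => ?_⟩
    obtain ⟨s, hs⟩ := h₁ α p (Set.subset_union_left.trans hp)
    obtain ⟨t, ht⟩ := h₂ α p (Set.subset_union_right.trans hp)
    exact ⟨s =' t, .equal s t, fun x xs => by rw [BoundedFormula.realize_bdEqual, hs, ht]⟩
  | le hf hg =>
    obtain ⟨S, hS, h₁⟩ := hf.exists_term
    obtain ⟨T, hT, h₂⟩ := hg.exists_term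
    refine ⟨S ∪ T, hS.union hT, fun α p hp => ?_⟩
    obtain ⟨s, hs⟩ := h₁ α p (Set.subset_union_left.trans hp)
    obtain ⟨t, ht⟩ := h₂ α p (Set.subset_union_right.trans hp)
    exact ⟨s.le t, .le s t, fun x xs => by rw [Term.realize_le, hs, ht]⟩
  | imp _ _ h₁ h₂ =>
    obtain ⟨S, hS, h₁⟩ := h₁
    obtain ⟨T, hT, h₂⟩ := h₂
    refine ⟨S ∪ T, hS.union hT, fun α p hp => ?_⟩
    obtain ⟨φ, hφ, hs⟩ := h₁ α p (Set.subset_union_left.trans hp)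
    obtain ⟨ψ, hψ, ht⟩ := h₂ α p (Set.subset_union_right.trans hp)
    exact ⟨φ ⟹ ψ, .imp hφ hψ, fun x xs => by rw [BoundedFormula.realize_imp, hs, ht]⟩
  | ball_snoc hf _ h₂ =>
    obtain ⟨S, hS, h₁⟩ := hf.exists_term
    obtain ⟨T, hT, h₂⟩ := h₂
    refine ⟨S ∪ T, hS.union hT, fun α p hp => ?_⟩
    obtain ⟨s, hs⟩ := h₁ α p (Set.subset_union_left.trans hp)
    obtain ⟨φ, hφ, ht⟩ := h₂ α p (Set.subset_union_right.trans hp)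
    refine ⟨_, .ball s hφ, fun x xs => ?_⟩
    simp only [BoundedFormula.realize_all, BoundedFormula.realize_imp, Term.realize_le,
      realize_up, realize_bvar, hs, ht]

theorem D0.congr {n : ℕ} {P Q : M → (Fin n → M) → Prop} (hP : D0 P)
    (h : ∀ x xs, Q x xs ↔ P x xs) : D0 Q := by
  rwa [show Q = P from funext fun x => funext fun xs => propext (h x xs)]

theorem D0.not {n : ℕ} {P : M → (Fin n → M) → Prop} (hP : D0 P) : D0 fun x xs => ¬ P x xs :=
  .imp hP .falsum

theorem D0.and {n : ℕ} {P Q : M → (Fin n → M) → Prop} (hP : D0 P) (hQ : D0 Q) :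
    D0 fun x xs => P x xs ∧ Q x xs :=
  (D0.not (.imp hP (.not hQ))).congr fun _ _ => by tauto

theorem D0.or {n : ℕ} {P Q : M → (Fin n → M) → Prop} (hP : D0 P) (hQ : D0 Q) :
    D0 fun x xs => P x xs ∨ Q x xs :=
  (D0.imp (.not hP) hQ).congr fun _ _ => by tauto

theorem D0.bex_snoc {n : ℕ} {f : M → (Fin n → M) → M} {P : M → (Fin (n + 1) → M) → Prop}
    (hf : IsTerm f) (hP : D0 P) : D0 fun x xs => ∃ y, y ≤ f x xs ∧ P x (Fin.snoc xs y) :=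
  (D0.not (.ball_snoc hf (.not hP))).congr fun _ _ => by push Not; rfl

/-- Reading the bound variable as the last coordinate, instead of through `Fin.snoc`, lets concrete
relations be matched by unification. -/
theorem D0.ball {n : ℕ} {f : M → (Fin n → M) → M} {P : M → (Fin n → M) → M → Prop}
    (hf : IsTerm f) (hP : D0 fun x (xs : Fin (n + 1) → M) => P x (Fin.init xs) (xs (Fin.last n))) :
    D0 fun x xs => ∀ y, y ≤ f x xs → P x xs y :=
  (D0.ball_snoc hf hP).congr fun _ _ => by simp

theorem D0.bex {n : ℕ} {f : M → (Fin n → M) → M} {P : M → (Fin n → M) → M → Prop}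
    (hf : IsTerm f) (hP : D0 fun x (xs : Fin (n + 1) → M) => P x (Fin.init xs) (xs (Fin.last n))) :
    D0 fun x xs => ∃ y, y ≤ f x xs ∧ P x xs y :=
  (D0.bex_snoc hf hP).congr fun _ _ => by simp

theorem IsTerm.realize {α : Type} {n m : ℕ} (t : arith.Term (α ⊕ Fin m))
    {f : α → M → (Fin n → M) → M} (hf : ∀ a, IsTerm (f a))
    {g : Fin m → M → (Fin n → M) → M} (hg : ∀ i, IsTerm (g i)) :
    IsTerm fun x xs => t.realize (Sum.elim (fun a => f a x xs) fun i => g i x xs) := by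
  induction t with
  | var i =>
    rcases i with a | i
    · exact hf a
    · exact hg i
  | func F ts ih =>
    cases F with
    | zero => exact .const 0
    | one => exact .const 1
    | add => exact .add (ih 0) (ih 1)
    | mul => exact .mul (ih 0) (ih 1)

theorem isTerm_snoc {n m : ℕ} {g : Fin m → M → (Fin n → M) → M} (hg : ∀ i, IsTerm (g i))
    (i : Fin (m + 1)) : IsTerm fun x (xs : Fin (n + 1) → M) =>
      Fin.snoc (α := fun _ => M) (fun i => g i x (Fin.init xs)) (xs (Fin.last n)) i := by
  induction i using Fin.lastCases with
  | last => simpa using IsTerm.last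
  | cast i => simpa using (hg i).init

/-- Substituting terms for the variables of a `Δ₀` formula gives a `Δ₀` relation. -/
theorem IsDelta0.d0_realize {α : Type} {m : ℕ} {φ : arith.BoundedFormula α m} (hφ : IsDelta0 φ) :
    ∀ {n : ℕ} {f : α → M → (Fin n → M) → M} (_ : ∀ a, IsTerm (f a))
      {g : Fin m → M → (Fin n → M) → M} (_ : ∀ i, IsTerm (g i)),
      D0 fun x xs => φ.Realize (fun a => f a x xs) fun i => g i x xs := by
  induction hφ with
  | falsum => intros; exact .falsum
  | equal s t => intro n f hf g hg; exact .equal (.realize s hf hg) (.realize t hf hg)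
  | le s t =>
    intro n f hf g hg
    exact (D0.le (.realize s hf hg) (.realize t hf hg)).congr fun _ _ => Term.realize_le
  | imp _ _ h₁ h₂ => intro n f hf g hg; exact .imp (h₁ hf hg) (h₂ hf hg)
  | ball t _ h =>
    intro n f hf g hg
    refine (D0.ball (P := fun x xs y => BoundedFormula.Realize _ (fun a => f a x xs)
      (Fin.snoc (fun i => g i x xs) y)) (.realize t hf hg)
      (h (fun a => (hf a).init) (isTerm_snoc hg))).congr fun x xs => ?_
    simp only [BoundedFormula.realize_all, BoundedFormula.realize_imp, Term.realize_le,
      realize_up, realize_bvar]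
  | bex t _ h =>
    intro n f hf g hg
    refine (D0.bex (P := fun x xs y => BoundedFormula.Realize _ (fun a => f a x xs)
      (Fin.snoc (fun i => g i x xs) y)) (.realize t hf hg)
      (h (fun a => (hf a).init) (isTerm_snoc hg))).congr fun x xs => ?_
    simp only [BoundedFormula.realize_ex, BoundedFormula.realize_inf, Term.realize_le,
      realize_up, realize_bvar]

/-- A formula with one free variable besides finitely many parameters, from a `Δ₀` relation. -/
theorem D0.exists_fin_formula {n : ℕ} {P : M → (Fin n → M) → Prop} (hP : D0 P) :
    ∃ (k : ℕ) (φ : arith.BoundedFormula (Fin k ⊕ Unit) n) (p : Fin k → M), IsDelta0 φ ∧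
        ∀ x xs, φ.Realize (Sum.elim p fun _ => x) xs ↔ P x xs := by
  obtain ⟨S, hS, h⟩ := hP.exists_formula
  obtain ⟨k, p, hp⟩ := hS.fin_param
  obtain ⟨φ, h₁, h₂⟩ := h (Fin k) p hp.2.ge
  exact ⟨k, φ, p, h₁, h₂⟩

theorem realize_inductionAxiom {k : ℕ} (φ : arith.Formula (Fin k ⊕ Unit)) :
    M ⊨ inductionAxiom φ ↔ ∀ p : Fin k → M, φ.Realize (Sum.elim p fun _ => 0) →
      (∀ x, φ.Realize (Sum.elim p fun _ => x) → φ.Realize (Sum.elim p fun _ => x + 1)) →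
      ∀ x, φ.Realize (Sum.elim p fun _ => x) := by
  rw [inductionAxiom, Sentence.Realize, Formula.realize_iAlls]
  refine forall_congr' fun p => ?_
  refine Formula.realize_relabel.trans ?_
  have e₀ : (fun a => (Sum.elim Term.var (fun _ => 0) a : arith.Term (Fin k)).realize p) =
      Sum.elim p fun _ : Unit => 0 := by
    funext a
    rcases a with a | a <;> rfl
  have e₁ : ∀ x : M, (fun a => (Sum.elim (fun i => Term.var (Sum.inl i))
      (fun _ => Term.var (Sum.inr ()) + 1) a : arith.Term (Fin k ⊕ Unit)).realize
        (Sum.elim p fun _ => x)) = Sum.elim p fun _ : Unit => x + 1 := by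
    intro x
    funext a
    rcases a with a | a <;> rfl
  refine BoundedFormula.realize_imp.trans (imp_congr ?_ (BoundedFormula.realize_imp.trans
    (imp_congr ?_ ?_)))
  · exact BoundedFormula.realize_subst.trans (by rw [← e₀]; rfl)
  · refine BoundedFormula.realize_iAlls.trans
      ((Equiv.funUnique Unit M).forall_congr_left.trans (forall_congr' fun x =>
        BoundedFormula.realize_imp.trans (imp_congr Iff.rfl ?_)))
    exact BoundedFormula.realize_subst.trans (by rw [← e₁]; rfl)
  · exact BoundedFormula.realize_iAlls.trans (Equiv.funUnique Unit M).forall_congr_left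

end Definability

/-! ### Exponentiation and division under Δ₀ induction. -/

section Exponentiation

variable {M : Type*} [CommSemiring M] [LinearOrder M]

/-- `r` is the `i`-th entry of the sequence coded by `(a, b)`. -/
def Beta (a b i r : M) : Prop := r ≤ (i + 1) * b ∧ ∃ q, a = q * ((i + 1) * b + 1) + r

/-- `(a, b)` codes a sequence whose entries with index up to `N` are the powers of two. -/
def Code (a b N : M) : Prop :=
  Beta a b 0 1 ∧ ∀ i, i < N → ∃ z, Beta a b i z ∧ Beta a b (i + 1) (z + z)

def IsExp (x y : M) : Prop := ∃ a b, Code a b x ∧ Beta a b x y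

variable (M) in
/-- The semantic content of `IΔ₀ + exp` beyond the axioms of ordered semirings. -/
class IsModel : Prop where
  one_le_of_pos : ∀ x : M, 0 < x → 1 ≤ x
  induction : ∀ P : M → Prop, D0 (n := 0) (fun x _ => P x) → P 0 → (∀ x, P x → P (x + 1)) → ∀ x, P x
  exists_exp : ∀ x : M, ∃ y, IsExp x y

theorem D0.lt {n : ℕ} {f g : M → (Fin n → M) → M} (hf : IsTerm f) (hg : IsTerm g) :
    D0 fun x xs => f x xs < g x xs :=
  (D0.not (.le hg hf)).congr fun _ _ => by simp

variable [IsStrictOrderedRing M] [CanonicallyOrderedAdd M]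

/-- A remainder is at most the dividend. This supplies the bounds that turn quantifiers over
sequence entries into bounded ones. -/
theorem Beta.le_code {a b i r : M} (h : Beta a b i r) : r ≤ a := by
  obtain ⟨_, q, rfl⟩ := h
  exact le_add_self

theorem D0.beta {n : ℕ} {a b i r : M → (Fin n → M) → M} (ha : IsTerm a) (hb : IsTerm b)
    (hi : IsTerm i) (hr : IsTerm r) : D0 fun x xs => Beta (a x xs) (b x xs) (i x xs) (r x xs) := by
  refine D0.congr (P := fun x xs => r x xs ≤ (i x xs + 1) * b x xs ∧
    ∃ q, q ≤ a x xs ∧ a x xs = q * ((i x xs + 1) * b x xs + 1) + r x xs) ?_ ?_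
  · exact .and (.le hr (.mul (.add hi (.const 1)) hb)) (.bex ha (.equal ha.init
      (.add (.mul .last (.add (.mul (.add hi.init (.const 1)) hb.init) (.const 1))) hr.init)))
  · refine fun x xs => and_congr Iff.rfl (exists_congr fun q => ⟨fun h => ⟨?_, h⟩, And.right⟩)
    rw [h]
    exact (le_mul_of_one_le_right zero_le le_add_self).trans le_self_add

variable [IsModel M]

theorem add_one_le_iff_lt {x y : M} : x + 1 ≤ y ↔ x < y := by
  constructor
  · exact fun h => (lt_add_one x).trans_le h
  · intro h
    obtain ⟨k, rfl⟩ := exists_add_of_le h.le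
    have := IsModel.one_le_of_pos k (by grind)
    grind

theorem lt_add_one_iff_le {x y : M} : x < y + 1 ↔ x ≤ y := by
  rw [← add_one_le_iff_lt]
  grind

theorem eq_zero_or_succ (x : M) : x = 0 ∨ ∃ y, x = y + 1 := by
  rcases eq_or_lt_of_le (zero_le (a := x)) with h | h
  · exact .inl h.symm
  · obtain ⟨y, rfl⟩ := exists_add_of_le (IsModel.one_le_of_pos x h)
    exact .inr ⟨y, add_comm _ _⟩

theorem quotient_le {d u v r s : M} (h : u * d + r = v * d + s) (hr : r < d) : v ≤ u := by
  by_contra! hlt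
  obtain ⟨k, rfl⟩ := exists_add_of_le (add_one_le_iff_lt.2 hlt)
  have : (u + 1 + k) * d = u * d + d + k * d := by ring
  have := zero_le (a := k * d)
  have := zero_le (a := s)
  grind

theorem division_unique {d u v r s : M} (h : u * d + r = v * d + s) (hr : r < d) (hs : s < d) :
    u = v ∧ r = s := by
  obtain rfl := le_antisymm (quotient_le h.symm hs) (quotient_le h hr)
  exact ⟨rfl, add_left_cancel h⟩

/-- The clause `r ≤ (i + 1) * b` says that `r` is below the modulus, so this is uniqueness of
remainders. -/
theorem Beta.unique {a b i r s : M} (hr : Beta a b i r) (hs : Beta a b i s) : r = s := by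
  obtain ⟨hr, u, rfl⟩ := hr
  obtain ⟨hs, v, h⟩ := hs
  exact (division_unique h (lt_add_one_iff_le.2 hr) (lt_add_one_iff_le.2 hs)).2

theorem Code.mono {a b N i : M} (h : Code a b N) (hi : i ≤ N) : Code a b i :=
  ⟨h.1, fun j hj => h.2 j (hj.trans_le hi)⟩

/-- Both sequences start with 1 and double at each step, so they agree by induction on `i`. The
redundant bound `z ≤ a` keeps the induction statement Δ₀. -/
theorem Code.beta_of_beta {a b N a' b' N' : M} (h : Code a b N) (h' : Code a' b' N') (i : M) :
    i ≤ N → i ≤ N' → ∀ z, z ≤ a → Beta a b i z → Beta a' b' i z := by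
  refine IsModel.induction (fun i => i ≤ N → i ≤ N' → ∀ z, z ≤ a → Beta a b i z → Beta a' b' i z)
    ?_ ?_ ?_ i
  · exact .imp (.le .main (.const _)) (.imp (.le .main (.const _)) (.ball (.const _)
      (.imp (.beta (.const _) (.const _) .main .last) (.beta (.const _) (.const _) .main .last))))
  · intro _ _ z _ hz
    rw [hz.unique h.1]
    exact h'.1
  · intro i ih hN hN' z _ hz
    obtain ⟨y, hy, hy'⟩ := h.2 i (add_one_le_iff_lt.1 hN)
    obtain ⟨w, hw, hw'⟩ := h'.2 i (add_one_le_iff_lt.1 hN')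
    have := ih (le_self_add.trans hN) (le_self_add.trans hN') y hy.le_code hy
    rw [hz.unique hy', this.unique hw]
    exact hw'

/-- The function `x ↦ 2 ^ x`. -/
noncomputable def ex (x : M) : M := (IsModel.exists_exp x).choose

theorem isExp_ex (x : M) : IsExp x (ex x) := (IsModel.exists_exp x).choose_spec

theorem exists_code (N : M) : ∃ a b, Code a b N := by
  obtain ⟨a, b, h, _⟩ := isExp_ex N
  exact ⟨a, b, h⟩

/-- Any code reaching `i` agrees with the one chosen for `ex i`. Hence, with one code as a
parameter, the graph of exponentiation up to `N` is Δ₀. -/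
theorem Code.beta_iff {a b N i y : M} (h : Code a b N) (hi : i ≤ N) :
    Beta a b i y ↔ y = ex i := by
  obtain ⟨a', b', h', hex⟩ := isExp_ex i
  have := h'.beta_of_beta h i le_rfl hi _ hex.le_code hex
  exact ⟨fun hy => hy.unique this, fun hy => hy ▸ this⟩

theorem isExp_iff {x y : M} : IsExp x y ↔ y = ex x :=
  ⟨fun ⟨_, _, h, hy⟩ => (h.beta_iff le_rfl).1 hy, fun h => h ▸ isExp_ex x⟩

@[simp] theorem ex_zero : ex (0 : M) = 1 := by
  obtain ⟨a, b, h⟩ := exists_code (0 : M)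
  exact ((h.beta_iff le_rfl).1 h.1).symm

theorem ex_succ (x : M) : ex (x + 1) = ex x + ex x := by
  obtain ⟨a, b, h⟩ := exists_code (x + 1)
  obtain ⟨z, hz, hz'⟩ := h.2 x (lt_add_one_iff_le.2 le_rfl)
  rw [← (h.beta_iff le_rfl).1 hz', (h.beta_iff le_self_add).1 hz]

/-- Induction for statements about the powers of two. -/
theorem ex_induction (s : M) {R : M → M → Prop}
    (hR : D0 fun x (xs : Fin 1 → M) => R x (xs 0)) (h₀ : R 0 (ex s))
    (h₁ : ∀ j, R j (ex (s + j)) → R (j + 1) (ex (s + j) + ex (s + j))) (j : M) : R j (ex (s + j)) := by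
  obtain ⟨a, b, h⟩ := exists_code (s + j)
  -- The single code for all powers up to `s + j` is a parameter here, and `y ≤ a` bounds the power,
  -- so the statement is Δ₀ in `i`.
  suffices ∀ i, i ≤ j → ∃ y, y ≤ a ∧ Beta a b (s + i) y ∧ R i y by
    obtain ⟨y, _, hy, hR⟩ := this j le_rfl
    rwa [← (h.beta_iff le_rfl).1 hy]
  refine IsModel.induction _ ?_ ?_ ?_
  · exact .imp (.le .main (.const _)) (.bex (.const _)
      (.and (.beta (.const _) (.const _) (.add (.const _) .main) .last) hR))
  · intro _
    have := (h.beta_iff (i := s + 0) (by grind)).2 rfl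
    exact ⟨_, this.le_code, this, by simpa using h₀⟩
  · intro i ih hi
    obtain ⟨y, _, hy, hRy⟩ := ih (le_self_add.trans hi)
    have hle : s + (i + 1) ≤ s + j := by grind
    have := (h.beta_iff hle).2 rfl
    refine ⟨_, this.le_code, this, ?_⟩
    rw [← add_assoc, ex_succ]
    rw [(h.beta_iff (add_le_add_right (le_self_add.trans hi) s)).1 hy] at hRy
    exact h₁ i hRy

theorem lt_ex (x : M) : x < ex x := by
  have := ex_induction (0 : M) (R := fun j y => j < y) (.lt .main (.var 0)) (by simp) ?_ x
  · simpa using this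
  · intro j hj
    have := add_one_le_iff_lt.2 hj
    have := zero_le (a := j)
    grind

theorem ex_pos (x : M) : 0 < ex x := zero_le.trans_lt (lt_ex x)

theorem ex_mono {x y : M} (h : x ≤ y) : ex x ≤ ex y := by
  obtain ⟨j, rfl⟩ := exists_add_of_le h
  refine ex_induction x (R := fun _ z => ex x ≤ z) (.le (.const _) (.var 0)) le_rfl ?_ j
  exact fun j hj => hj.trans le_self_add

/-- Here `ex q + ex q` is 2 ^ (q + 1): adding multiples of 2 ^ p will therefore leave the digit at
`q` unchanged. -/
theorem exists_ex_eq_mul {q p : M} (h : q < p) : ∃ k, ex p = (ex q + ex q) * k := by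
  obtain ⟨j, rfl⟩ := exists_add_of_le (add_one_le_iff_lt.2 h)
  have := ex_induction (q + 1) (R := fun _ z => ∃ k, k ≤ z ∧ z = (ex q + ex q) * k)
    (.bex (.var 0) (.equal (.var 0) (.mul (.const _) .last))) ?_ ?_ j
  · exact ⟨_, this.choose_spec.2⟩
  · exact ⟨1, IsModel.one_le_of_pos _ (ex_pos _),
      by rw [ex_succ, mul_one]⟩
  · rintro j ⟨k, hk, hz⟩
    exact ⟨k + k, by grind, by rw [mul_add, ← hz]⟩

theorem exists_division (c : M) {d : M} (hd : 0 < d) : ∃ u r, c = u * d + r ∧ r < d := by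
  have := IsModel.induction (fun c => ∃ u, u ≤ c ∧ ∃ r, r ≤ c ∧ c = u * d + r ∧ r < d) ?_ ?_ ?_ c
  · obtain ⟨u, _, r, _, h⟩ := this
    exact ⟨u, r, h⟩
  · exact .bex .main (.bex .main (.and (.equal .main (.add (.mul (.var 0) (.const _)) .last))
      (.lt .last (.const _))))
  · exact ⟨0, le_rfl, 0, le_rfl, by simp, hd⟩
  · rintro c ⟨u, hu, r, hr, rfl, hrd⟩
    rcases (add_one_le_iff_lt.2 hrd).eq_or_lt with h | h
    · exact ⟨u + 1, by grind, 0, by simp, by rw [← h]; ring, hd⟩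
    · exact ⟨u, hu.trans le_self_add, r + 1, by grind, by ring, h⟩

theorem not_even_and_odd {x y : M} : x + x ≠ y + y + 1 := by
  intro h
  have hlt : (1 : M) < 2 := one_lt_two
  have : x * 2 + 0 = y * 2 + 1 := by rw [mul_two, mul_two, h, add_zero]
  exact zero_ne_one (division_unique this two_pos hlt).2

theorem even_or_odd' (x : M) : ∃ y, x = y + y ∨ x = y + y + 1 := by
  obtain ⟨y, r, h, hr⟩ := exists_division x (two_pos (α := M))
  rcases eq_zero_or_succ r with rfl | ⟨s, rfl⟩
  · exact ⟨y, .inl (by rw [h]; ring)⟩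
  · refine ⟨y, .inr ?_⟩
    have : s = 0 := le_antisymm (lt_add_one_iff_le.1 (by rw [← one_add_one_eq_two] at hr; grind)) zero_le
    rw [h, this]; ring

end Exponentiation

/-! ### Sets coded in binary, and exponential towers. -/

section Towers

variable {M : Type*} [CommSemiring M] [LinearOrder M]

/-- `BitAt e c`: the binary digit of `c` at the power of two `e` is `1`. -/
def BitAt (e c : M) : Prop := ∃ u, u ≤ c ∧ ∃ r, r ≤ c ∧ c = (u + u + 1) * e + r ∧ r < e

/-- `Bit p c` with the powers of two read off from the code `(a, b)`. -/
def BitC (a b p c : M) : Prop := p ≤ c ∧ ∃ e, e ≤ c ∧ Beta a b p e ∧ BitAt e c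

theorem D0.bitAt {n : ℕ} {e c : M → (Fin n → M) → M} (he : IsTerm e) (hc : IsTerm c) :
    D0 fun x xs => BitAt (e x xs) (c x xs) :=
  .bex hc (.bex hc.init (.and
    (.equal hc.init.init (.add (.mul (.add (.add (.var (Fin.last n).castSucc)
      (.var (Fin.last n).castSucc)) (.const 1)) he.init.init) .last))
    (.lt .last he.init.init)))

/-- The position used to store the pair `(i, t)` in a set coded in binary. -/
def pair (i t : M) : M := (i + t) * (i + t) + i

theorem IsTerm.pair {n : ℕ} {f g : M → (Fin n → M) → M} (hf : IsTerm f) (hg : IsTerm g) :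
    IsTerm fun x xs => pair (f x xs) (g x xs) :=
  .add (.mul (.add hf hg) (.add hf hg)) hf

/-- `(a, b)` witnesses that the set coded by `c` is a partial tower of exponentials. -/
def TowC (a b c : M) : Prop := ∀ i, i ≤ c → ∀ t, t ≤ c → BitC a b (pair i t) c →
  (i = 0 ∧ t = 1) ∨ ∃ i', i' ≤ c ∧ ∃ t', t' ≤ c ∧ i = i' + 1 ∧ Beta a b t' t ∧
    BitC a b (pair i' t') c

variable [IsStrictOrderedRing M] [CanonicallyOrderedAdd M]

theorem D0.bitC {n : ℕ} {a b p c : M → (Fin n → M) → M} (ha : IsTerm a) (hb : IsTerm b)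
    (hp : IsTerm p) (hc : IsTerm c) : D0 fun x xs => BitC (a x xs) (b x xs) (p x xs) (c x xs) :=
  .and (.le hp hc) (.bex hc (.and (.beta ha.init hb.init hp.init .last) (.bitAt .last hc.init)))

theorem D0.towC {n : ℕ} {a b c : M → (Fin n → M) → M} (ha : IsTerm a) (hb : IsTerm b)
    (hc : IsTerm c) : D0 fun x xs => TowC (a x xs) (b x xs) (c x xs) :=
  .ball hc <| .ball hc.init <| .imp
    (.bitC ha.init.init hb.init.init (.pair (.var (Fin.last n).castSucc) .last) hc.init.init) <|
    .or (.and (.equal (.var (Fin.last n).castSucc) (.const 0)) (.equal .last (.const 1))) <|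
      .bex hc.init.init <| .bex hc.init.init.init <| .and
        (.equal (.var (Fin.last n).castSucc.castSucc.castSucc)
          (.add (.var (Fin.last _).castSucc) (.const 1))) <|
        .and (.beta ha.init.init.init.init hb.init.init.init.init .last
          (.var (Fin.last _).castSucc.castSucc)) <|
        .bitC ha.init.init.init.init hb.init.init.init.init (.pair (.var (Fin.last _).castSucc) .last)
          hc.init.init.init.init

theorem D0.code {n : ℕ} {a b N : M → (Fin n → M) → M} (ha : IsTerm a) (hb : IsTerm b)
    (hN : IsTerm N) : D0 fun x xs => Code (a x xs) (b x xs) (N x xs) := by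
  refine D0.congr (P := fun x xs => Beta (a x xs) (b x xs) 0 1 ∧ ∀ i, i ≤ N x xs → i < N x xs →
    ∃ z, z ≤ a x xs ∧ Beta (a x xs) (b x xs) i z ∧ Beta (a x xs) (b x xs) (i + 1) (z + z)) ?_ ?_
  · exact .and (.beta ha hb (.const _) (.const _)) <| .ball hN <| .imp (.lt .last hN.init) <|
      .bex ha.init <| .and (.beta ha.init.init hb.init.init (.var (Fin.last n).castSucc) .last) <|
        .beta ha.init.init hb.init.init (.add (.var (Fin.last n).castSucc) (.const 1))
          (.add .last .last)
  · exact fun x xs => and_congr Iff.rfl (forall_congr' fun i =>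
      ⟨fun h _ hi => (h hi).imp fun z hz => ⟨hz.1.le_code, hz⟩,
        fun h hi => (h hi.le hi).imp fun z hz => hz.2⟩)

/-- With s = i + t, the code s² + i is below (s + 1)², so codes with a larger sum lie strictly
higher. -/
theorem pair_lt_of_add_lt {i t i' t' : M} (h : i + t + 1 ≤ i' + t') : pair i t < pair i' t' := by
  have h₁ : (i + t + 1) * (i + t + 1) ≤ (i' + t') * (i' + t') := mul_le_mul' h h
  have h₂ : (i + t + 1) * (i + t + 1) = (i + t) * (i + t) + i + i + t + t + 1 := by ring
  have := zero_le (a := i)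
  have := zero_le (a := i')
  have := zero_le (a := t)
  have := zero_lt_one (α := M)
  unfold pair
  grind

theorem left_le_pair (i t : M) : i ≤ pair i t := le_add_self

variable [IsModel M]

theorem right_le_pair (i t : M) : t ≤ pair i t := by
  refine le_trans ?_ le_self_add
  rcases eq_zero_or_succ t with rfl | ⟨s, rfl⟩
  · exact zero_le
  · refine le_trans le_add_self (le_mul_of_one_le_right zero_le ?_)
    rw [← add_assoc]
    exact le_add_self

theorem pair_inj {i t i' t' : M} (h : pair i t = pair i' t') : i = i' ∧ t = t' := by
  have h₁ : i + t = i' + t' := by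
    rcases lt_trichotomy (i + t) (i' + t') with h₁ | h₁ | h₁
    · exact absurd h (pair_lt_of_add_lt (add_one_le_iff_lt.2 h₁)).ne
    · exact h₁
    · exact absurd h (pair_lt_of_add_lt (add_one_le_iff_lt.2 h₁)).ne'
  unfold pair at h
  rw [h₁] at h
  grind

/-- A tower entry is stored below its successor, so an insertion at the successor's position
preserves it. -/
theorem pair_lt_pair_succ (i t : M) : pair i t < pair (i + 1) (ex t) := by
  refine pair_lt_of_add_lt ?_
  have := lt_ex t
  grind

/-- The binary digit of `c` at position `p` is `1`, that is, `p` is in the set coded by `c`. -/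
def Bit (p c : M) : Prop := BitAt (ex p) c

theorem bit_iff {p c : M} : Bit p c ↔ ∃ u r, c = (u + u + 1) * ex p + r ∧ r < ex p := by
  refine ⟨fun ⟨u, _, r, _, h⟩ => ⟨u, r, h⟩, fun ⟨u, r, h⟩ => ⟨u, ?_, r, ?_, h⟩⟩
  · rw [h.1]
    refine le_trans ?_ le_self_add
    refine le_trans ?_ (le_mul_of_one_le_right zero_le (IsModel.one_le_of_pos _ (ex_pos p)))
    rw [add_assoc]
    exact le_self_add
  · rw [h.1]
    exact le_add_self

theorem Bit.ex_le {p c : M} (h : Bit p c) : ex p ≤ c := by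
  obtain ⟨u, r, rfl, _⟩ := bit_iff.1 h
  exact (le_mul_of_one_le_left zero_le le_add_self).trans le_self_add

theorem Bit.lt {p c : M} (h : Bit p c) : p < c := (lt_ex p).trans_le h.ex_le

/-- A digit 1 at `p` forces p < 2 ^ p ≤ c ≤ N, so a code reaching `N` sees every relevant power. -/
theorem Code.bitC_iff {a b N p c : M} (h : Code a b N) (hc : c ≤ N) : BitC a b p c ↔ Bit p c := by
  constructor
  · rintro ⟨hp, e, _, he, hb⟩
    rwa [(h.beta_iff (hp.trans hc)).1 he] at hb
  · exact fun hb => ⟨hb.lt.le, ex p, hb.ex_le, (h.beta_iff (hb.lt.le.trans hc)).2 rfl, hb⟩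

theorem D0.bit {n : ℕ} {p : M → (Fin n → M) → M} (hp : IsTerm p) (c : M) :
    D0 fun x xs => Bit (p x xs) c := by
  obtain ⟨a, b, h⟩ := exists_code c
  exact (D0.bitC (.const a) (.const b) hp (.const c)).congr fun _ _ => (h.bitC_iff le_rfl).symm

theorem bit_mul_add_iff {q p v r : M} (h : q < p) : Bit q (v * ex p + r) ↔ Bit q r := by
  obtain ⟨k, hk⟩ := exists_ex_eq_mul h
  simp only [bit_iff, hk]
  constructor
  · rintro ⟨u, s, hu, hs⟩
    obtain ⟨w, s', rfl, hs'⟩ := exists_division r (ex_pos q)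
    have h₁ : (v * k + v * k + w) * ex q + s' = (u + u + 1) * ex q + s := by
      rw [← hu]
      ring
    obtain ⟨h₂, rfl⟩ := division_unique h₁ hs' hs
    -- The quotients of `r` and of the full number by 2 ^ q differ by the even number `v * k + v *
    -- k`, so `w` has to be odd.
    obtain ⟨y, rfl | rfl⟩ := even_or_odd' w
    · refine absurd (?_ : (v * k + y) + (v * k + y) = u + u + 1) not_even_and_odd
      rw [← h₂]
      ring
    · exact ⟨y, s', rfl, hs⟩
  · rintro ⟨u, s, rfl, hs⟩
    exact ⟨v * k + u, s, by ring, hs⟩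

/-- Every set has an extension which agrees with it below `p` and has largest element `p`. -/
theorem exists_insert (p c : M) :
    ∃ c', Bit p c' ∧ (∀ q, q < p → (Bit q c' ↔ Bit q c)) ∧ ∀ q, Bit q c' → q ≤ p := by
  obtain ⟨v, r, rfl, hr⟩ := exists_division c (ex_pos p)
  -- Reduce `c` modulo 2 ^ p, discarding all digits from `p` upwards, then set the digit at `p`.
  refine ⟨1 * ex p + r, bit_iff.2 ⟨0, r, by simp, hr⟩, fun q hq => ?_, fun q hq => ?_⟩
  · rw [bit_mul_add_iff hq, bit_mul_add_iff hq]
  · by_contra! hlt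
    have h₁ := ex_mono (add_one_le_iff_lt.2 hlt)
    have h₂ := hq.ex_le
    rw [ex_succ] at h₁
    grind

/-- Every element `(i, t)` of the set coded by `c` either is `(0, 1)` or arises from another element
`(i', t')` as `(i' + 1, 2 ^ t')`. -/
def Tow (c : M) : Prop := ∀ i t, Bit (pair i t) c →
  (i = 0 ∧ t = 1) ∨ ∃ i' t', i = i' + 1 ∧ t = ex t' ∧ Bit (pair i' t') c

/-- `t` is the value of an exponential tower of height `x`. -/
def IsTower (x t : M) : Prop := ∃ c, Tow c ∧ Bit (pair x t) c

theorem Code.towC_iff {a b c : M} (h : Code a b c) : TowC a b c ↔ Tow c := by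
  constructor
  · intro H i t hb
    refine (H i ((left_le_pair i t).trans hb.lt.le) t ((right_le_pair i t).trans hb.lt.le)
      ((h.bitC_iff le_rfl).2 hb)).imp_right ?_
    rintro ⟨i', hi', t', ht', hi, ht, hb⟩
    exact ⟨i', t', hi, (h.beta_iff ht').1 ht, (h.bitC_iff le_rfl).1 hb⟩
  · intro H i _ t _ hb
    refine (H i t ((h.bitC_iff le_rfl).1 hb)).imp_right ?_
    rintro ⟨i', t', hi, ht, hb⟩
    have ht' := (right_le_pair i' t').trans hb.lt.le
    exact ⟨i', (left_le_pair i' t').trans hb.lt.le, t', ht', hi, (h.beta_iff ht').2 ht,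
      (h.bitC_iff le_rfl).2 hb⟩

/-- Naming the code of the powers of two puts the relation into Σ₁ form: what remains inside the
quantifiers is Δ₀. -/
theorem isTower_iff {x t : M} :
    IsTower x t ↔ ∃ c a b, Code a b c ∧ TowC a b c ∧ BitC a b (pair x t) c := by
  constructor
  · rintro ⟨c, h, hb⟩
    obtain ⟨a, b, hc⟩ := exists_code c
    exact ⟨c, a, b, hc, hc.towC_iff.2 h, (hc.bitC_iff le_rfl).2 hb⟩
  · rintro ⟨c, a, b, hc, h, hb⟩
    exact ⟨c, hc.towC_iff.1 h, (hc.bitC_iff le_rfl).1 hb⟩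

theorem isTower_zero : IsTower (0 : M) 1 := by
  obtain ⟨c, h₁, h₂, h₃⟩ := exists_insert (pair (0 : M) 1) 0
  refine ⟨c, fun i t hb => ?_, h₁⟩
  rcases (h₃ _ hb).lt_or_eq with h | h
  · exact absurd ((h₂ _ h).1 hb).lt not_lt_zero
  · exact .inl (pair_inj h)

/-- Inserting the new pair may delete entries at higher positions, but every surviving entry keeps
its predecessor, which sits lower. -/
theorem IsTower.succ {x t : M} (h : IsTower x t) : IsTower (x + 1) (ex t) := by
  obtain ⟨c, hc, hb⟩ := h
  obtain ⟨c', h₁, h₂, h₃⟩ := exists_insert (pair (x + 1) (ex t)) c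
  refine ⟨c', fun i s hs => ?_, h₁⟩
  rcases (h₃ _ hs).lt_or_eq with h | h
  · refine (hc i s ((h₂ _ h).1 hs)).imp_right ?_
    rintro ⟨i', t', rfl, rfl, hb'⟩
    exact ⟨i', t', rfl, rfl, (h₂ _ ((pair_lt_pair_succ i' t').trans h)).2 hb'⟩
  · obtain ⟨rfl, rfl⟩ := pair_inj h
    exact .inr ⟨x, t, rfl, rfl, (h₂ _ (pair_lt_pair_succ x t)).2 hb⟩

theorem IsTower.exists_of_le {x t y : M} (h : IsTower x t) (hy : y ≤ x) : ∃ s, IsTower y s := by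
  obtain ⟨c, hc, hb⟩ := h
  obtain ⟨j, rfl⟩ := exists_add_of_le hy
  -- Descend from the top of the tower along predecessors inside `c`; `k` counts the steps taken.
  suffices ∀ k, ∀ i, i ≤ y + j → i + k = y + j → ∃ s, s ≤ c ∧ Bit (pair i s) c by
    obtain ⟨s, _, hs⟩ := this j y le_self_add rfl
    exact ⟨s, c, hc, hs⟩
  refine IsModel.induction _ ?_ ?_ ?_
  · exact .ball (.const _) <| .imp (.equal (.add .last .main) (.const _)) <| .bex (.const _) <|
      .bit (.pair (.var 0) .last) c
  · rintro i _ h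
    rw [add_zero] at h
    subst h
    exact ⟨t, (right_le_pair _ _).trans hb.lt.le, hb⟩
  · intro k ih i _ hk
    obtain ⟨s, _, hs⟩ := ih (i + 1) (by rw [← hk, add_comm k, ← add_assoc]; exact le_self_add)
      (by rw [← hk]; ring)
    rcases hc _ _ hs with ⟨h, _⟩ | ⟨i', t', h, _, hb'⟩
    · exact absurd h (zero_lt_one.trans_le le_add_self).ne'
    · obtain rfl := add_right_cancel h
      exact ⟨t', (right_le_pair _ _).trans hb'.lt.le, hb'⟩

/-- Strip one exponential from both towers at a time. The case of equal heights also gives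
uniqueness of the tower value. -/
theorem IsTower.mono {x t y s : M} (h : IsTower x t) (h' : IsTower y s) (hxy : x ≤ y) : t ≤ s := by
  obtain ⟨c, hc, hb⟩ := h
  obtain ⟨d, hd, hb'⟩ := h'
  -- With both coded sets fixed as parameters, all the other entries are bounded by them and the
  -- induction on `x` is Δ₀.
  suffices ∀ x, ∀ t, t ≤ c → ∀ y, y ≤ d → ∀ s, s ≤ d → Bit (pair x t) c → Bit (pair y s) d →
      x ≤ y → t ≤ s from this x t ((right_le_pair _ _).trans hb.lt.le) y
    ((left_le_pair _ _).trans hb'.lt.le) s ((right_le_pair _ _).trans hb'.lt.le) hb hb' hxy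
  refine IsModel.induction _ ?_ ?_ ?_
  · exact .ball (.const _) <| .ball (.const _) <| .ball (.const _) <|
      .imp (.bit (.pair .main (.var 0)) c) <| .imp (.bit (.pair (.var 1) (.var 2)) d) <|
      .imp (.le .main (.var 1)) (.le (.var 0) (.var 2))
  · intro t _ y _ s _ hb hb' _
    rcases hc _ _ hb with ⟨_, rfl⟩ | ⟨i', t', h, _⟩
    · rcases hd _ _ hb' with ⟨_, rfl⟩ | ⟨i', t', _, rfl, _⟩
      · exact le_rfl
      · exact IsModel.one_le_of_pos _ (ex_pos _)
    · exact absurd h (zero_lt_one.trans_le le_add_self).ne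
  · intro x ih t _ y _ s _ hb hb' hxy
    rcases hc _ _ hb with ⟨h, _⟩ | ⟨i, t', h, rfl, hi⟩
    · exact absurd h (zero_lt_one.trans_le le_add_self).ne'
    · obtain rfl := add_right_cancel h
      rcases hd _ _ hb' with ⟨rfl, _⟩ | ⟨j, s', rfl, rfl, hj⟩
      · exact absurd hxy (zero_lt_one.trans_le le_add_self).not_ge
      · exact ex_mono (ih t' ((right_le_pair _ _).trans hi.lt.le) j
          ((left_le_pair _ _).trans hj.lt.le) s' ((right_le_pair _ _).trans hj.lt.le) hi hj
          (by simpa using hxy))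

end Towers

/-! ### Σ₁ cuts and the passage to closure under exponentiation. -/

section SigmaOne

variable {M : Type*} [CommSemiring M] [LinearOrder M]

/-- The set `J` is defined by one existential quantifier followed by a `Δ₀` relation, with
parameters. -/
def IsSigma (J : Set M) : Prop :=
  ∃ Q : M → M → Prop, (∀ {n : ℕ} {f g : M → (Fin n → M) → M}, IsTerm f → IsTerm g →
    D0 fun x xs => Q (f x xs) (g x xs)) ∧ ∀ x, x ∈ J ↔ ∃ w, Q w x

theorem IsSigma.isSigma1Definable {J : Set M} (h : IsSigma J) : IsSigma1Definable J := by
  obtain ⟨Q, hQ, hJ⟩ := h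
  obtain ⟨k, φ, p, hφ, h⟩ :=
    (hQ (n := 1) (f := fun _ xs => xs 0) (g := fun x _ => x) (.var 0) .main).exists_fin_formula
  refine ⟨k, ∃' φ, p, .ex (.of_delta0 hφ), fun x => ?_⟩
  rw [hJ, Formula.Realize, BoundedFormula.realize_ex]
  exact exists_congr fun w => (h x (Fin.snoc default w)).symm

/-- A single `w` bounds a whole block of witnesses. Stability under substitution of terms is carried
along so that `Q` can be used inside further Δ₀ relations. -/
theorem IsSigma1.exists_d0 {α : Type} {m : ℕ} {φ : arith.BoundedFormula α m} (hφ : IsSigma1 φ) :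
    ∃ Q : M → (α → M) → (Fin m → M) → Prop,
      (∀ {n : ℕ} {h : M → (Fin n → M) → M} {f : α → M → (Fin n → M) → M}
        {g : Fin m → M → (Fin n → M) → M}, IsTerm h → (∀ a, IsTerm (f a)) → (∀ i, IsTerm (g i)) →
        D0 fun x xs => Q (h x xs) (fun a => f a x xs) fun i => g i x xs) ∧
      ∀ v ys, φ.Realize v ys ↔ ∃ w, Q w v ys := by
  induction hφ with
  | of_delta0 hφ =>
    exact ⟨fun _ v ys => BoundedFormula.Realize _ v ys, fun _ hf hg => hφ.d0_realize hf hg,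
      fun v ys => ⟨fun h => ⟨0, h⟩, fun ⟨_, h⟩ => h⟩⟩
  | ex _ ih =>
    obtain ⟨Q, hQ, h⟩ := ih
    refine ⟨fun w v ys => ∃ y, y ≤ w ∧ ∃ u, u ≤ w ∧ Q u v (Fin.snoc ys y), ?_, fun v ys => ?_⟩
    · intro n k f g hk hf hg
      exact .bex (P := fun x xs y => ∃ u, u ≤ k x xs ∧
          Q u (fun a => f a x xs) (Fin.snoc (fun i => g i x xs) y)) hk <|
        .bex (P := fun x xs u => Q u (fun a => f a x (Fin.init xs))
          (Fin.snoc (fun i => g i x (Fin.init xs)) (xs (Fin.last n)))) hk.init <|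
        hQ .last (fun a => (hf a).init.init) fun i => (isTerm_snoc hg i).init
    · simp only [BoundedFormula.realize_ex, h]
      exact ⟨fun ⟨y, u, h⟩ => ⟨max y u, y, le_max_left _ _, u, le_max_right _ _, h⟩,
        fun ⟨_, y, _, u, _, h⟩ => ⟨y, u, h⟩⟩

variable [IsStrictOrderedRing M] [CanonicallyOrderedAdd M] [IsModel M]

/-- A failure of `Σ₁` induction yields a proper `Σ₁` cut. -/
theorem exists_cut_of_not_induction {k : ℕ} {φ : arith.Formula (Fin k ⊕ Unit)} (hφ : IsSigma1 φ)
    {p : Fin k → M} (h₀ : φ.Realize (Sum.elim p fun _ => 0))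
    (h₁ : ∀ x, φ.Realize (Sum.elim p fun _ => x) → φ.Realize (Sum.elim p fun _ => x + 1))
    {d : M} (hd : ¬ φ.Realize (Sum.elim p fun _ => d)) :
    ∃ J : Set M, IsCut J ∧ IsSigma J ∧ d ∉ J := by
  obtain ⟨Q, hQ, h⟩ := hφ.exists_d0 (M := M)
  have h' : ∀ x, φ.Realize (Sum.elim p fun _ => x) ↔ ∃ w, Q w (Sum.elim p fun _ => x) default :=
    fun x => h _ _
  simp only [h'] at h₀ h₁ hd
  -- One `w` must bound witnesses for all `y ≤ x` at once: Σ₁ collection is not available to move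
  -- the existential quantifier outwards.
  refine ⟨{x | ∃ w, ∀ y, y ≤ x → ∃ u, u ≤ w ∧ Q u (Sum.elim p fun _ => y) default},
    ⟨?_, ?_, ?_⟩, ⟨_, ?_, fun x => Iff.rfl⟩, ?_⟩
  · obtain ⟨w, hw⟩ := h₀
    refine ⟨0, w, fun y hy => ⟨w, le_rfl, ?_⟩⟩
    rwa [nonpos_iff_eq_zero.1 hy]
  · exact fun x ⟨w, hw⟩ y hy => ⟨w, fun z hz => hw z (hz.trans hy)⟩
  · rintro x ⟨w, hw⟩
    obtain ⟨u, _, hu⟩ := hw x le_rfl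
    obtain ⟨w', hw'⟩ := h₁ x ⟨u, hu⟩
    refine ⟨max w w', fun y hy => ?_⟩
    rcases hy.lt_or_eq with hy | rfl
    · obtain ⟨v, hv, hv'⟩ := hw y (lt_add_one_iff_le.1 hy)
      exact ⟨v, hv.trans (le_max_left _ _), hv'⟩
    · exact ⟨w', le_max_right _ _, hw'⟩
  · intro n f g hf hg
    refine .ball hg (.bex hf.init ((hQ (n := n + 2) (h := fun _ xs => xs (Fin.last _))
      (f := Sum.elim (fun i _ _ => p i) fun _ _ xs => xs (Fin.last n).castSucc)
      (g := fun i => i.elim0) .last ?_ fun i => i.elim0).congr fun x xs => ?_))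
    · rintro (i | i)
      · exact .const _
      · exact .var _
    · rw [iff_iff_eq]
      congr 1
      · funext i
        rcases i with i | i <;> rfl
      · exact Subsingleton.elim _ _
  · rintro ⟨w, hw⟩
    obtain ⟨u, _, hu⟩ := hw d le_rfl
    exact hd ⟨u, hu⟩

/-- `w` bounds the witnesses for `IsTower x t`. -/
def TowerWitness (w x t : M) : Prop :=
  ∃ c, c ≤ w ∧ ∃ a, a ≤ w ∧ ∃ b, b ≤ w ∧ Code a b c ∧ TowC a b c ∧ BitC a b (pair x t) c

theorem D0.towerWitness {n : ℕ} {w x t : M → (Fin n → M) → M} (hw : IsTerm w) (hx : IsTerm x)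
    (ht : IsTerm t) : D0 fun z xs => TowerWitness (w z xs) (x z xs) (t z xs) :=
  have c := IsTerm.var (M := M) (Fin.last n).castSucc.castSucc
  have a := IsTerm.var (M := M) (Fin.last (n + 1)).castSucc
  .bex hw <| .bex hw.init <| .bex hw.init.init <| .and (.code a .last c) <|
    .and (.towC a .last c) (.bitC a .last (.pair hx.init.init.init ht.init.init.init) c)

theorem isTower_iff_exists_witness {x t : M} : IsTower x t ↔ ∃ w, TowerWitness w x t := by
  rw [isTower_iff]
  constructor
  · rintro ⟨c, a, b, h⟩
    exact ⟨max c (max a b), c, by simp, a, by simp, b, by simp, h⟩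
  · rintro ⟨w, c, _, a, _, b, _, h⟩
    exact ⟨c, a, b, h⟩

variable (M) in
/-- The heights of the exponential towers which exist in `M`. -/
def towerHeights : Set M := {x | ∃ t, IsTower x t}

theorem isCut_towerHeights : IsCut (towerHeights M) where
  nonempty := ⟨0, 1, isTower_zero⟩
  downward := fun _ ⟨_, h⟩ _ hy => h.exists_of_le hy
  succ := fun _ ⟨_, h⟩ => ⟨_, h.succ⟩

theorem isSigma_towerHeights : IsSigma (towerHeights M) := by
  refine ⟨fun w x => ∃ t, t ≤ w ∧ ∃ v, v ≤ w ∧ TowerWitness v x t, fun hf hg =>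
    .bex hf (.bex hf.init (.towerWitness .last hg.init.init (.var (Fin.last _).castSucc))),
    fun x => ⟨?_, ?_⟩⟩
  · rintro ⟨t, h⟩
    obtain ⟨v, hv⟩ := isTower_iff_exists_witness.1 h
    exact ⟨max t v, t, by simp, v, by simp, hv⟩
  · rintro ⟨w, t, _, v, _, h⟩
    exact ⟨t, isTower_iff_exists_witness.2 ⟨v, h⟩⟩

/-- A `Σ₁` cut strictly below the height of some exponential tower yields a proper `Σ₁` cut closed
under exponentiation. -/
theorem exists_exp_closed_of_tower {I : Set M} (hI : IsCut I) (hI' : IsSigma I) {a : M}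
    (ha : a ∉ I) (ht : a ∈ towerHeights M) :
    ∃ J : Set M, IsCut J ∧ J ≠ Set.univ ∧ IsSigma J ∧ ∀ x ∈ J, ex x ∈ J := by
  obtain ⟨T, hT⟩ := ht
  obtain ⟨Q, hQ, hI'⟩ := hI'
  have hlt : ∀ x ∈ I, x ≤ a := fun x hx => by
    by_contra! h
    exact ha (hI.downward x hx a h.le)
  have hex : ∀ y, (∃ x t, x ∈ I ∧ IsTower x t ∧ y ≤ t) → ∃ x t, x ∈ I ∧ IsTower x t ∧ ex y ≤ t :=
    fun y ⟨x, t, hx, ht, hy⟩ => ⟨x + 1, ex t, hI.succ x hx, ht.succ, ex_mono hy⟩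
  -- The cut consists of everything below a tower whose height is in `I`; it is proper because it
  -- omits `T + 1`, where `T` is the tower of height `a`.
  refine ⟨{y | ∃ x t, x ∈ I ∧ IsTower x t ∧ y ≤ t}, ⟨?_, ?_, ?_⟩, fun h => ?_, ?_, hex⟩
  · obtain ⟨x, hx⟩ := hI.nonempty
    exact ⟨0, 0, 1, hI.downward x hx 0 zero_le, isTower_zero, zero_le⟩
  · exact fun y ⟨x, t, hx, ht, hy⟩ z hz => ⟨x, t, hx, ht, hz.trans hy⟩
  · intro y hy
    obtain ⟨x, t, hx, ht, hy⟩ := hex y hy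
    exact ⟨x, t, hx, ht, (add_one_le_iff_lt.2 (lt_ex y)).trans hy⟩
  · obtain ⟨x, t, hx, ht, hy⟩ := h.ge (Set.mem_univ (T + 1))
    exact (lt_add_one T).not_ge (hy.trans (ht.mono hT (hlt x hx)))
  · refine ⟨fun w y => ∃ x, x ≤ w ∧ ∃ t, t ≤ w ∧ ∃ u, u ≤ w ∧ ∃ v, v ≤ w ∧
      Q u x ∧ TowerWitness v x t ∧ y ≤ t, ?_, fun y => ⟨?_, ?_⟩⟩
    · intro n f g hf hg
      have x := IsTerm.var (M := M) (Fin.last n).castSucc.castSucc.castSucc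
      have t := IsTerm.var (M := M) (Fin.last (n + 1)).castSucc.castSucc
      exact .bex hf <| .bex hf.init <| .bex hf.init.init <| .bex hf.init.init.init <|
        .and (hQ (.var (Fin.last _).castSucc) x) <| .and (.towerWitness .last x t)
          (.le hg.init.init.init.init t)
    · rintro ⟨x, t, hx, ht, hy⟩
      obtain ⟨u, hu⟩ := (hI' x).1 hx
      obtain ⟨v, hv⟩ := isTower_iff_exists_witness.1 ht
      exact ⟨max (max x t) (max u v), x, by simp, t, by simp, u, by simp, v, by simp, hu, hv, hy⟩
    · rintro ⟨w, x, _, t, _, u, _, v, _, hu, hv, hy⟩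
      exact ⟨x, t, (hI' x).2 ⟨u, hu⟩, isTower_iff_exists_witness.2 ⟨v, hv⟩, hy⟩

theorem IsSigma.preimage_add {I : Set M} (hI : IsSigma I) (a : M) : IsSigma {x | a + x ∈ I} := by
  obtain ⟨Q, hQ, hI⟩ := hI
  exact ⟨fun w x => Q w (a + x), fun hf hg => hQ hf (.add (.const a) hg), fun x => hI _⟩

theorem IsSigma.preimage_ex {I : Set M} (hI : IsSigma I) : IsSigma {x | ex x ∈ I} := by
  obtain ⟨Q, hQ, hI⟩ := hI
  refine ⟨fun w x => ∃ a, a ≤ w ∧ ∃ b, b ≤ w ∧ ∃ u, u ≤ w ∧ ∃ y, y ≤ a ∧ Code a b x ∧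
    Beta a b x y ∧ Q u y, ?_, fun x => ⟨fun h => ?_, ?_⟩⟩
  · intro n f g hf hg
    have a := IsTerm.var (M := M) (Fin.last n).castSucc.castSucc.castSucc
    have b := IsTerm.var (M := M) (Fin.last (n + 1)).castSucc.castSucc
    have u := IsTerm.var (M := M) (Fin.last (n + 2)).castSucc
    have hg := hg.init.init.init.init
    exact .bex hf <| .bex hf.init <| .bex hf.init.init <|
      .bex (.var (Fin.last n).castSucc.castSucc) <| .and (.code a b hg) <|
        .and (.beta a b hg .last) (hQ u .last)
  · obtain ⟨a, b, hc⟩ := exists_code x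
    obtain ⟨u, hu⟩ := (hI _).1 h
    have := (hc.beta_iff le_rfl).2 rfl
    exact ⟨max a (max b u), a, by simp, b, by simp, u, by simp, ex x, this.le_code, hc, this, hu⟩
  · rintro ⟨w, a, _, b, _, u, _, y, _, hc, hy, hu⟩
    rw [(hc.beta_iff le_rfl).1 hy] at hu
    exact (hI _).2 ⟨u, hu⟩

theorem IsCut.preimage_add {I : Set M} (hI : IsCut I) {a : M} (ha : a ∈ I) :
    IsCut {x | a + x ∈ I} where
  nonempty := ⟨0, by simpa using ha⟩
  downward := fun _ hx _ hy => hI.downward _ hx _ (add_le_add_right hy a)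
  succ := fun x hx => by
    rw [Set.mem_ofPred_eq, ← add_assoc]
    exact hI.succ _ hx

/-- A successor in the exponent doubles the power, hence the closure of `I` under doubling. -/
theorem IsCut.preimage_ex {I : Set M} (hI : IsCut I) (h : ∀ x ∈ I, x + x ∈ I) :
    IsCut {x | ex x ∈ I} where
  nonempty := by
    obtain ⟨x, hx⟩ := hI.nonempty
    refine ⟨0, ?_⟩
    have := hI.succ 0 (hI.downward x hx 0 zero_le)
    simpa using this
  downward := fun _ hx _ hy => hI.downward _ hx _ (ex_mono hy)
  succ := fun x hx => by
    rw [Set.mem_ofPred_eq, ex_succ]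
    exact h _ hx

/-- Any proper `Σ₁` cut can be replaced by one which is closed under exponentiation. -/
theorem exists_exp_closed {I : Set M} (hI : IsCut I) (hI' : IsSigma I) {d : M} (hd : d ∉ I) :
    ∃ J : Set M, IsCut J ∧ J ≠ Set.univ ∧ IsSigma J ∧ ∀ x ∈ J, ex x ∈ J := by
  by_cases h₁ : towerHeights M ⊆ I
  · by_cases h₂ : ∀ x ∈ towerHeights M, x + x ∈ towerHeights M
    · by_cases h₃ : ∀ x ∈ towerHeights M, ex x ∈ towerHeights M
      · exact ⟨_, isCut_towerHeights, fun h => hd (h₁ (h ▸ Set.mem_univ d)), isSigma_towerHeights, h₃⟩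
      · push Not at h₃
        obtain ⟨a, ha, ha'⟩ := h₃
        -- The element `a` is a tower height outside {x | 2 ^ x is a tower height}.
        exact exists_exp_closed_of_tower (isCut_towerHeights.preimage_ex h₂)
          isSigma_towerHeights.preimage_ex ha' ha
    · push Not at h₂
      obtain ⟨a, ha, ha'⟩ := h₂
      -- The element `a` is a tower height outside {x | a + x is a tower height}.
      exact exists_exp_closed_of_tower (isCut_towerHeights.preimage_add ha)
        (isSigma_towerHeights.preimage_add a) ha' ha
  · obtain ⟨a, ha, ha'⟩ := Set.not_subset.1 h₁
    exact exists_exp_closed_of_tower hI hI' ha' ha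

end SigmaOne

/-! ### From the axioms of PA⁻ to their algebraic content. -/

/-- The algebraic content of `PA⁻`. -/
structure PAMinus (M : Type*) [Zero M] [One M] [Add M] [Mul M] [LE M] : Prop where
  le_refl : ∀ a : M, a ≤ a
  le_antisymm : ∀ a b : M, a ≤ b → b ≤ a → a = b
  le_trans : ∀ a b c : M, a ≤ b → b ≤ c → a ≤ c
  le_total : ∀ a b : M, a ≤ b ∨ b ≤ a
  add_assoc : ∀ a b c : M, a + b + c = a + (b + c)
  add_comm : ∀ a b : M, a + b = b + a
  mul_assoc : ∀ a b c : M, a * b * c = a * (b * c)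
  mul_comm : ∀ a b : M, a * b = b * a
  mul_add : ∀ a b c : M, a * (b + c) = a * b + a * c
  add_zero : ∀ a : M, a + 0 = a
  mul_zero : ∀ a : M, a * 0 = 0
  mul_one : ∀ a : M, a * 1 = a
  add_lt_add : ∀ a b c : M, a ≤ b ∧ ¬ b ≤ a → a + c ≤ b + c ∧ ¬ b + c ≤ a + c
  mul_lt_mul : ∀ a b c : M, 0 ≤ c ∧ ¬ c ≤ 0 → a ≤ b ∧ ¬ b ≤ a → a * c ≤ b * c ∧ ¬ b * c ≤ a * c
  exists_add : ∀ a b : M, a ≤ b ∧ ¬ b ≤ a → ∃ c, a + c = b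
  zero_lt_one : (0 : M) ≤ 1 ∧ ¬ (1 : M) ≤ 0
  one_le : ∀ a : M, 0 ≤ a ∧ ¬ a ≤ 0 → 1 ≤ a
  zero_le : ∀ a : M, 0 ≤ a

theorem PAMinus.of_models {M : Type*} [Zero M] [One M] [Add M] [Mul M] [LE M]
    (h : M ⊨ paMinus) : PAMinus M := by
  simp only [paMinus, linearOrderTheory, partialOrderTheory, preorderTheory, Theory.model_iff,
    Set.mem_union, Set.mem_insert_iff, Set.mem_singleton_iff, or_imp, forall_and, forall_eq,
    Relations.realize_total, Relations.realize_antisymmetric, Relations.realize_transitive,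
    Relations.realize_reflexive] at h
  simp only [Sentence.Realize, Formula.Realize, Term.lt, BoundedFormula.realize_all,
    BoundedFormula.realize_ex, BoundedFormula.realize_imp, BoundedFormula.realize_inf,
    BoundedFormula.realize_not, BoundedFormula.realize_bdEqual, Term.realize_le, realize_add,
    realize_mul, realize_zero, realize_one] at h
  obtain ⟨⟨h₁, h₂, h₃, h₄⟩, h₅, h₆, h₇, h₈, h₉, h₁₀, h₁₁, h₁₂, h₁₃, h₁₄, h₁₅, h₁₆, h₁₇, h₁₈⟩ := h
  exact ⟨h₃.1, h₂.1, h₄.1, h₁.1, h₅, h₆, h₇, h₈, h₉, h₁₀, h₁₁, h₁₂, h₁₃, h₁₄, h₁₅, h₁₆, h₁₇, h₁₈⟩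

/-! ### Interpretation of the arithmetical axioms in a model. -/

section Models

variable {M : Type*} [CommSemiring M] [LinearOrder M]

theorem realize_betaGraph {α : Type} {n : ℕ} (a b i r : arith.Term (α ⊕ Fin n)) (v : α → M)
    (xs : Fin n → M) : (betaGraph a b i r).Realize v xs ↔
      Beta (a.realize (Sum.elim v xs)) (b.realize (Sum.elim v xs)) (i.realize (Sum.elim v xs))
        (r.realize (Sum.elim v xs)) := by
  simp only [betaGraph, BoundedFormula.realize_inf, Term.realize_le, BoundedFormula.realize_ex,
    BoundedFormula.realize_bdEqual, realize_add, realize_mul, realize_one, realize_up,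
    realize_bvar, Beta]

theorem realize_expGraph (v : Fin 2 → M) : expGraph.Realize v ↔ IsExp (v 0) (v 1) := by
  simp only [expGraph, Formula.Realize, BoundedFormula.realize_inf, BoundedFormula.realize_ex,
    BoundedFormula.realize_all, BoundedFormula.realize_imp, realize_betaGraph, Term.realize_lt,
    IsExp, Code]
  rfl

theorem realize_expAxiom : M ⊨ expAxiom ↔ ∀ x : M, ∃ y, IsExp x y := by
  rw [expAxiom, Sentence.Realize, Formula.Realize]
  simp only [BoundedFormula.realize_all, BoundedFormula.realize_ex]
  refine forall_congr' fun x => exists_congr fun y => ?_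
  refine (BoundedFormula.realize_relabel ..).trans ?_
  exact (realize_expGraph _)

theorem induction_of_models (h : M ⊨ IDelta0) (P : M → Prop) (hP : D0 (n := 0) fun x _ => P x)
    (h₀ : P 0) (h₁ : ∀ x, P x → P (x + 1)) (x : M) : P x := by
  obtain ⟨k, φ, p, hφ, hr⟩ := hP.exists_fin_formula
  have hr : ∀ x, Formula.Realize φ (Sum.elim p fun _ => x) ↔ P x := fun x => hr x _
  have := (realize_inductionAxiom φ).1
    (Theory.realize_sentence_of_mem IDelta0 (.inr ⟨k, φ, hφ, rfl⟩)) p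
  simp only [hr] at this
  exact this h₀ h₁ x

variable [IsStrictOrderedRing M] [CanonicallyOrderedAdd M] [IsModel M]

theorem exists_exp_closed_cut_of_not_models (h : M ⊨ paMinus) (hS : ¬ M ⊨ ISigma1) :
    ∃ J : Set M, IsCut J ∧ J ≠ Set.univ ∧ IsSigma1Definable J ∧ ClosedUnderExp J := by
  have : ∃ (k : ℕ) (φ : arith.Formula (Fin k ⊕ Unit)), IsSigma1 φ ∧ ¬ M ⊨ inductionAxiom φ := by
    by_contra! hc
    refine hS ((Theory.model_union_iff).2 ⟨h, (Theory.model_iff _).2 ?_⟩)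
    rintro _ ⟨k, φ, hφ, rfl⟩
    exact hc k φ hφ
  obtain ⟨k, φ, hφ, hn⟩ := this
  rw [realize_inductionAxiom] at hn
  push Not at hn
  obtain ⟨p, h₀, h₁, d, hd⟩ := hn
  obtain ⟨I, hI, hI', hdI⟩ := exists_cut_of_not_induction hφ h₀ h₁ hd
  obtain ⟨J, hJ, hJu, hJs, hJe⟩ := exists_exp_closed hI hI' hdI
  refine ⟨J, hJ, hJu, hJs.isSigma1Definable, fun x hx y hy => ?_⟩
  have hxy : y = ex x := isExp_iff.1 ((realize_expGraph ![x, y]).1 hy)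
  rw [hxy]
  exact hJe x hx

end Models

/-! ### The ordered semiring structure of a model. -/

section Instances

variable {M : Type*} [Zero M] [One M] [Add M] [Mul M] [LE M]

/-- The ring operations of a model of `PA⁻`. -/
abbrev PAMinus.commSemiring (h : PAMinus M) : CommSemiring M where
  add_assoc := h.add_assoc
  add_comm := h.add_comm
  add_zero := h.add_zero
  zero_add a := by rw [h.add_comm, h.add_zero]
  mul_assoc := h.mul_assoc
  mul_comm := h.mul_comm
  mul_one := h.mul_one
  one_mul a := by rw [h.mul_comm, h.mul_one]
  mul_zero := h.mul_zero
  zero_mul a := by rw [h.mul_comm, h.mul_zero]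
  left_distrib := h.mul_add
  right_distrib a b c := by rw [h.mul_comm, h.mul_add, h.mul_comm c a, h.mul_comm c b]
  nsmul := nsmulRec
  npow := npowRec

open Classical in
/-- The order of a model of `PA⁻`. -/
noncomputable abbrev PAMinus.linearOrder (h : PAMinus M) : LinearOrder M where
  le_refl := h.le_refl
  le_trans := h.le_trans
  le_antisymm := h.le_antisymm
  le_total := h.le_total
  toDecidableLE := Classical.decRel _

theorem PAMinus.add_le_add (h : PAMinus M) {a b : M} (hab : a ≤ b) (c : M) : a + c ≤ b + c := by
  by_cases hba : b ≤ a
  · rw [h.le_antisymm a b hab hba]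
    exact h.le_refl _
  · exact (h.add_lt_add a b c ⟨hab, hba⟩).1

theorem PAMinus.isStrictOrderedRing (h : PAMinus M) :
    letI := h.commSemiring
    letI := h.linearOrder
    IsStrictOrderedRing M := by
  let _ := h.commSemiring
  let _ := h.linearOrder
  have hadd : ∀ a b : M, a ≤ b → ∀ c, a + c ≤ b + c := fun a b hab c => h.add_le_add hab c
  have hmul : ∀ c : M, 0 < c → ∀ a b : M, a < b → a * c < b * c :=
    fun c hc a b hab => h.mul_lt_mul a b c hc hab
  exact
    { add_le_add_left := hadd
      le_of_add_le_add_left := fun a b c hbc => by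
        by_contra hcb
        have := (h.add_lt_add c b a (lt_of_not_ge hcb)).2
        rw [h.add_comm b, h.add_comm c] at this
        exact this hbc
      zero_le_one := h.zero_lt_one.1
      exists_pair_ne := ⟨0, 1, fun h' => h.zero_lt_one.2 (h' ▸ h.le_refl 0)⟩
      mul_lt_mul_of_pos_left := fun c hc a b hab => by
        simpa only [h.mul_comm c] using hmul c hc a b hab
      mul_lt_mul_of_pos_right := hmul }

theorem PAMinus.canonicallyOrderedAdd (h : PAMinus M) : CanonicallyOrderedAdd M where
  exists_add_of_le {a b} hab := by
    by_cases hba : b ≤ a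
    · exact ⟨0, by rw [h.add_zero, h.le_antisymm a b hab hba]⟩
    · obtain ⟨c, hc⟩ := h.exists_add a b ⟨hab, hba⟩
      exact ⟨c, hc.symm⟩
  le_add_self a b := by
    have := h.add_le_add (h.zero_le b) a
    rwa [h.add_comm 0, h.add_zero] at this
  le_self_add a b := by
    have := h.add_le_add (h.zero_le b) a
    rwa [h.add_comm 0, h.add_zero, h.add_comm b] at this

end Instances

end Arith

theorem lemma3p1 {M : Type*} [Zero M] [One M] [Add M] [Mul M] [LE M]
    (hM : M ⊨ Arith.IDelta0 ∪ {Arith.expAxiom}) (hS : ¬ M ⊨ Arith.ISigma1) :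
    ∃ J : Set M, Arith.IsCut J ∧ J ≠ Set.univ ∧ Arith.IsSigma1Definable J ∧
      Arith.ClosedUnderExp J := by
  have hI : M ⊨ Arith.IDelta0 := hM.mono Set.subset_union_left
  have hexp : M ⊨ Arith.expAxiom := (Theory.model_iff _).1 hM _ (Or.inr rfl)
  have hP : M ⊨ Arith.paMinus := hI.mono Set.subset_union_left
  have h := Arith.PAMinus.of_models hP
  -- These instances reuse the given operations and order, so realizations of formulas are
  -- unchanged.
  let _ := h.commSemiring
  let _ := h.linearOrder
  have := h.isStrictOrderedRing
  have : CanonicallyOrderedAdd M := h.canonicallyOrderedAdd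
  have : Arith.IsModel M :=
    { one_le_of_pos := h.one_le
      induction := Arith.induction_of_models hI
      exists_exp := Arith.realize_expAxiom.1 hexp }
  exact Arith.exists_exp_closed_cut_of_not_models hP hS
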